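/- Let $A$ be a unital C*-algebra, $P\subseteq A$ a C*-subalgebra containing $1_A$, and $E\colon A\to P$ a conditional expectation (a positive contractive linear $P$-bimodule map with $E|_P=\mathrm{id}$) of index-finite type, i.e. there are $u_1,v_1,\dots,u_n,v_n\in A$ with $x=\sum_i u_iE(v_ix)=\sum_i E(xu_i)v_i$ for all $x\in A$; put $\operatorname{Index}E=\sum_i u_iv_i\in A$, which does not depend on the choice of the $u_i,v_i$. Let $A^\infty=\ell^\infty(\mathbb N,A)/c_0(\mathbb N,A)$, in which $A$ is embedded as constant sequences, and let $E^\infty\colon A^\infty\to A^\infty$ be the map $[(x_n)]\mapsto[(E(x_n))]$. Suppose that $E$ has the tracial Rokhlin property: for every nonzero positive $z\in A^\infty$ there is a projection $e\in A'\cap A^\infty$ such that 1. $g=(\operatorname{Index}E)\,E^\infty(e)$ is a projection, 2. $1-g$ is Murray--von Neumann equivalent in $A^\infty$ to a projection in the hereditary subalgebra $\overline{zA^\infty z}$, and 3. the map $A\ni x\mapsto xe\in A^\infty$ is injective. For positive elements $a,b$ of a C*-algebra $B$, write $a\precsim b$ in $B$ if there is a sequence $(x_k)$ in $B$ with $\|x_k^*bx_k-a\|\to0$.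 If $a,b\in P$ are positive and $a\precsim b$ in $A$, then $a\precsim b$ in $P$. -/

import Mathlib

open Filter Topology
open scoped BoundedContinuousFunction

noncomputable section

/-! ### The sequence algebra `A^∞ = ℓ^∞(ℕ, A) / c₀(ℕ, A)` -/

/-- The closed two-sided ideal `c₀(ℕ, A)` of the algebra `ℓ^∞(ℕ, A)` of bounded sequences
(bounded functions on the discrete space `ℕ`). -/
def nullSeq (A : Type*) [CStarAlgebra A] : Ideal (ℕ →ᵇ A) where
  carrier := {x | Tendsto (fun n => ‖x n‖) atTop (𝓝 0)}
  zero_mem' := by simp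
  add_mem' := by
    intro x y hx hy
    refine squeeze_zero (fun _ => norm_nonneg _) (fun n => norm_add_le (x n) (y n)) ?_
    simpa using Tendsto.add hx hy
  smul_mem' := by
    intro c x hx
    refine squeeze_zero (g := fun n => ‖c‖ * ‖x n‖) (fun _ => norm_nonneg _) (fun n => ?_) ?_
    · exact (norm_mul_le (c n) (x n)).trans
        (mul_le_mul_of_nonneg_right (c.norm_coe_le_norm n) (norm_nonneg _))
    · simpa using Tendsto.const_mul ‖c‖ hx

theorem mem_nullSeq {A : Type*} [CStarAlgebra A] {x : ℕ →ᵇ A} :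
    x ∈ nullSeq A ↔ Tendsto (fun n => ‖x n‖) atTop (𝓝 0) := Iff.rfl

instance nullSeq_isTwoSided (A : Type*) [CStarAlgebra A] : (nullSeq A).IsTwoSided where
  mul_mem_of_left := by
    intro x c hx
    refine squeeze_zero (g := fun n => ‖x n‖ * ‖c‖) (fun _ => norm_nonneg _) (fun n => ?_) ?_
    · exact (norm_mul_le (x n) (c n)).trans
        (mul_le_mul_of_nonneg_left (c.norm_coe_le_norm n) (norm_nonneg _))
    · simpa using Tendsto.mul_const ‖c‖ (mem_nullSeq.1 hx)

/-- `A^∞ = ℓ^∞(ℕ, A) / c₀(ℕ, A)`, with the ring structure and the norm (topology) of the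
quotient. -/
abbrev SeqAlg (A : Type*) [CStarAlgebra A] : Type _ := (ℕ →ᵇ A) ⧸ nullSeq A

namespace SeqAlg

variable {A B : Type*} [CStarAlgebra A] [CStarAlgebra B]

/-- The class `[(x_n)]` in `A^∞` of a bounded sequence. -/
def mk (x : ℕ →ᵇ A) : SeqAlg A := Ideal.Quotient.mk (nullSeq A) x

theorem mk_surjective : Function.Surjective (mk : (ℕ →ᵇ A) → SeqAlg A) :=
  Ideal.Quotient.mk_surjective

theorem mk_eq_mk {x y : ℕ →ᵇ A} :
    mk x = mk y ↔ Tendsto (fun n => ‖x n - y n‖) atTop (𝓝 0) :=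
  Ideal.Quotient.eq

/-- The involution `[(x_n)]^* = [(x_n^*)]` makes `A^∞` a star ring. -/
instance : StarRing (SeqAlg A) where
  star := Quotient.map' (fun x => star x) (by
    intro x y h
    refine (Submodule.quotientRel_def _).2 (mem_nullSeq.2 ?_)
    have h' := mem_nullSeq.1 ((Submodule.quotientRel_def _).1 h)
    refine h'.congr fun n => ?_
    change ‖x n - y n‖ = ‖star (x n) - star (y n)‖
    rw [← star_sub, norm_star])
  star_involutive := by
    intro x
    obtain ⟨x, rfl⟩ := mk_surjective x
    exact congrArg mk (star_star x)
  star_mul := by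
    intro x y
    obtain ⟨x, rfl⟩ := mk_surjective x
    obtain ⟨y, rfl⟩ := mk_surjective y
    exact congrArg mk (star_mul x y)
  star_add := by
    intro x y
    obtain ⟨x, rfl⟩ := mk_surjective x
    obtain ⟨y, rfl⟩ := mk_surjective y
    exact congrArg mk (star_add x y)

theorem star_mk (x : ℕ →ᵇ A) : star (mk x) = mk (star x) := rfl

/-- The canonical embedding of `A` into `A^∞` as constant sequences. -/
def const (a : A) : SeqAlg A := mk (BoundedContinuousFunction.const ℕ a)

/-- The map `T^∞ : A^∞ → B^∞`, `[(x_n)] ↦ [(T x_n)]`, induced by a bounded linear map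
`T : A → B`. -/
def map (T : A →L[ℂ] B) : SeqAlg A → SeqAlg B :=
  Quotient.map' (fun x => T.compLeftContinuousBounded ℕ x) (by
    intro x y h
    refine (Submodule.quotientRel_def _).2 (mem_nullSeq.2 ?_)
    have h' := mem_nullSeq.1 ((Submodule.quotientRel_def _).1 h)
    refine squeeze_zero (g := fun n => ‖T‖ * ‖x n - y n‖) (fun _ => norm_nonneg _)
      (fun n => ?_) (by simpa using h'.const_mul ‖T‖)
    change ‖T (x n) - T (y n)‖ ≤ _
    rw [← map_sub]
    exact T.le_opNorm _)

theorem map_mk (T : A →L[ℂ] B) (x : ℕ →ᵇ A) :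
    map T (mk x) = mk (T.compLeftContinuousBounded ℕ x) := rfl

end SeqAlg

/-! ### Murray–von Neumann and Cuntz comparison, hereditary subalgebras -/

/-- Murray–von Neumann equivalence: `p = v^* v` and `q = v v^*` for some `v`. -/
def MurrayVonNeumannEquiv {B : Type*} [Mul B] [Star B] (p q : B) : Prop :=
  ∃ v : B, star v * v = p ∧ v * star v = q

/-- The hereditary C*-subalgebra generated by a positive element `z`: the norm closure of
`z B z`. -/
def hereditarySubalgebra {B : Type*} [Mul B] [TopologicalSpace B] (z : B) : Set B :=
  closure {y | ∃ x : B, y = z * x * z}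

/-- Cuntz subequivalence `a ≾ b` in `B`: there is a sequence `x_k` in `B` with
`x_k^* b x_k → a`. -/
def CuntzSubequiv {B : Type*} [Mul B] [Star B] [TopologicalSpace B] (a b : B) : Prop :=
  ∃ x : ℕ → B, Tendsto (fun k => star (x k) * b * x k) atTop (𝓝 a)

/-! ### Conditional expectations, index, and the tracial Rokhlin property -/

/-- A conditional expectation `E : A → P` onto a unital *-subalgebra `P` of `A`: a positive
contractive linear `P`-bimodule map restricting to the identity on `P`. -/
structure ConditionalExpectation {A : Type*} [CStarAlgebra A] [PartialOrder A]
    [StarOrderedRing A] (P : StarSubalgebra ℂ A) where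
  /-- the underlying bounded linear map -/
  toCLM : A →L[ℂ] P
  map_coe : ∀ p : P, toCLM (p : A) = p
  map_mul_left : ∀ (p : P) (x : A), toCLM ((p : A) * x) = p * toCLM x
  map_mul_right : ∀ (x : A) (p : P), toCLM (x * (p : A)) = toCLM x * p
  map_nonneg : ∀ x : A, 0 ≤ x → 0 ≤ (toCLM x : A)
  norm_map_le : ∀ x : A, ‖toCLM x‖ ≤ ‖x‖

namespace ConditionalExpectation

variable {A : Type*} [CStarAlgebra A] [PartialOrder A] [StarOrderedRing A]
  {P : StarSubalgebra ℂ A}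

/-- `E` regarded as a bounded linear map from `A` to `A` with range `P`. -/
def toSelf (E : ConditionalExpectation P) : A →L[ℂ] A :=
  P.toSubalgebra.toSubmodule.subtypeL.comp E.toCLM

theorem toSelf_apply (E : ConditionalExpectation P) (x : A) : E.toSelf x = (E.toCLM x : A) :=
  rfl

/-- A finite family `(u_i, v_i)` in `A × A` is a quasi-basis for `E` if
`x = ∑ u_i E(v_i x) = ∑ E(x u_i) v_i` for all `x ∈ A`. -/
def IsQuasiBasis (E : ConditionalExpectation P) {n : ℕ} (u v : Fin n → A) : Prop :=
  ∀ x : A, ∑ i, u i * E.toSelf (v i * x) = x ∧ ∑ i, E.toSelf (x * u i) * v i = x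

/-- `E` is of index-finite type (in the sense of Watatani) if it has a quasi-basis. -/
def IndexFiniteType (E : ConditionalExpectation P) : Prop :=
  ∃ (n : ℕ) (u v : Fin n → A), E.IsQuasiBasis u v

/-- `Index E = ∑ u_i v_i` for a quasi-basis `(u_i, v_i)` (and `0` if there is none);
see `index_eq` for the independence of the choice. -/
def index (E : ConditionalExpectation P) : A :=
  open Classical in
  if h : E.IndexFiniteType then
    ∑ i, h.choose_spec.choose i * h.choose_spec.choose_spec.choose i
  else 0

theorem IsQuasiBasis.sum_eq {E : ConditionalExpectation P} {n m : ℕ} {u v : Fin n → A}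
    {s t : Fin m → A} (h : E.IsQuasiBasis u v) (k : E.IsQuasiBasis s t) :
    ∑ i, u i * v i = ∑ j, s j * t j := by
  calc ∑ i, u i * v i = ∑ i, u i * ∑ j, E.toSelf (v i * s j) * t j :=
        Finset.sum_congr rfl fun i _ => by rw [(k (v i)).2]
    _ = ∑ j, (∑ i, u i * E.toSelf (v i * s j)) * t j := by
        simp only [Finset.mul_sum, Finset.sum_mul, mul_assoc]
        exact Finset.sum_comm
    _ = ∑ j, s j * t j := Finset.sum_congr rfl fun j _ => by rw [(h (s j)).1]

/-- The index does not depend on the quasi-basis. -/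
theorem index_eq {E : ConditionalExpectation P} {n : ℕ} {u v : Fin n → A}
    (h : E.IsQuasiBasis u v) : E.index = ∑ i, u i * v i := by
  have hE : E.IndexFiniteType := ⟨n, u, v, h⟩
  rw [index, dif_pos hE]
  exact hE.choose_spec.choose_spec.choose_spec.sum_eq h

/-- `E` has the tracial Rokhlin property: for every nonzero positive `z ∈ A^∞` there is a
projection `e ∈ A' ∩ A^∞` such that `g = (Index E) E^∞(e)` is a projection, `1 - g` is
Murray–von Neumann equivalent to a projection in the hereditary subalgebra of `A^∞` generated
by `z`, and `A ∋ x ↦ x e` is injective. Positive elements of `A^∞` are those of the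
form `y^* y`. -/
def TracialRokhlinProperty (E : ConditionalExpectation P) : Prop :=
  ∀ z : SeqAlg A, z ≠ 0 → (∃ y : SeqAlg A, z = star y * y) →
    ∃ e : SeqAlg A, IsStarProjection e ∧
      (∀ x : A, SeqAlg.const x * e = e * SeqAlg.const x) ∧
      ∃ g : SeqAlg A, g = SeqAlg.const E.index * SeqAlg.map E.toSelf e ∧
        IsStarProjection g ∧
        (∃ q ∈ hereditarySubalgebra z, IsStarProjection q ∧ MurrayVonNeumannEquiv (1 - g) q) ∧
        Function.Injective fun x : A => SeqAlg.const x * e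

end ConditionalExpectation

end

/-!
Apply the tracial Rokhlin property to the indicator sequence `z` of the even numbers. Everything in
the hereditary subalgebra of `z` vanishes along the odd numbers, so passing to that subsequence
removes the defect `1 - g` and turns `e` into a projection commuting with `A` for which
`J E^∞(e) = 1`, where `J = Index E`. Put `β(x) = J E^∞(e x)`. Since `J` is central and lies in `P`,
`β` takes values in the fixed points of `E^∞` and fixes `P`. For a quasi-basis of the form
`(w_i, w_i^*)` one computes `∑ (w_i - β(w_i)) (w_i - β(w_i))^* = J (1 - e) + (1 - e) J`, which `e`
compresses to `0`. So `e β(w_i) = e w_i`, hence `e β(x) = e x` for all `x`, and `β` is a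
`*`-homomorphism on `A`. It sends `x_k^* b x_k → a` to `β(x_k)^* b β(x_k) → a`, and the entries of
representatives of the `β(x_k)` in `P` witness the comparison there.
-/

/-! ### Positivity in C*-algebras and matrix algebras -/

section CStarAlgebra

theorem eq_zero_of_pow_three_eq_zero {B : Type*} [CStarAlgebra B] {a : B} (ha : IsSelfAdjoint a)
    (h : a ^ 3 = 0) : a = 0 := by
  have hsq : a ^ 2 = 0 := by
    rw [← CStarRing.star_mul_self_eq_zero_iff, (ha.pow 2).star_eq, ← pow_add, pow_succ, h, zero_mul]
  rw [← CStarRing.star_mul_self_eq_zero_iff, ha.star_eq, ← sq, hsq]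

theorem negPart_mul_mul_negPart {B : Type*} [CStarAlgebra B] {a : B} (ha : IsSelfAdjoint a) :
    a⁻ * a * a⁻ = -(a⁻) ^ 3 := by
  calc a⁻ * a * a⁻ = a⁻ * (a⁺ - a⁻) * a⁻ := by rw [CFC.posPart_sub_negPart a ha]
    _ = -(a⁻) ^ 3 := by
      rw [mul_sub, CFC.negPart_mul_posPart, zero_sub, neg_mul, pow_succ, sq]

theorem exists_eq_star_mul_self_of_compression {B : Type*} [CStarAlgebra B] {M : B}
    (hM : IsSelfAdjoint M) (h : ∀ t r : B, star t * M * t = -(star r * r) → r = 0) :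
    ∃ s, M = star s * s := by
  let _ := CStarAlgebra.spectralOrder B
  have := CStarAlgebra.spectralOrderedRing B
  have hneg : IsSelfAdjoint M⁻ := (CFC.negPart_nonneg M).isSelfAdjoint
  obtain ⟨s, hs⟩ := CStarAlgebra.nonneg_iff_eq_star_mul_self.1 (CFC.negPart_nonneg M)
  have hcube : star (s * M⁻) * (s * M⁻) = M⁻ ^ 3 := by
    rw [star_mul, hneg.star_eq, mul_assoc, ← mul_assoc (star s), ← hs, pow_succ', sq]
  have hzero : s * M⁻ = 0 :=
    h M⁻ (s * M⁻) (by rw [hneg.star_eq, negPart_mul_mul_negPart hM, hcube])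
  rw [hzero, mul_zero] at hcube
  exact CStarAlgebra.nonneg_iff_eq_star_mul_self.1
    ((CFC.negPart_eq_zero_iff M hM).1 (eq_zero_of_pow_three_eq_zero hneg hcube.symm))

variable {B : Type*} [CStarAlgebra B] [PartialOrder B] [StarOrderedRing B]

theorem eq_zero_of_sum_star_mul_self_nonpos {ι : Type*} [Fintype ι] {r : ι → B}
    (h : ∑ i, star (r i) * r i ≤ 0) (i : ι) : r i = 0 := by
  have hr := (Fintype.sum_eq_zero_iff_of_nonneg fun i => star_mul_self_nonneg (r i)).1
    (h.antisymm (Finset.sum_nonneg fun i _ => star_mul_self_nonneg (r i)))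
  exact (CStarRing.star_mul_self_eq_zero_iff _).1 (congrFun hr i)

theorem cstarMatrix_exists_eq_star_mul_self {n : Type*} [Fintype n]
    {M : CStarMatrix n n B} (hM : IsSelfAdjoint M)
    (h : ∀ p : n → B, 0 ≤ ∑ i, ∑ j, star (p i) * M i j * p j) :
    ∃ R : CStarMatrix n n B, M = star R * R := by
  classical
  refine exists_eq_star_mul_self_of_compression (B := CStarMatrix n n B) hM fun T R hTR => ?_
  ext k j
  have hform : ∑ i, star (R i j) * R i j = -∑ i, ∑ l, star (T i j) * M i l * T l j := by
    calc ∑ i, star (R i j) * R i j = (star R * R) j j := by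
          simp only [CStarMatrix.mul_apply, CStarMatrix.star_apply]
      _ = -(star T * M * T) j j := by rw [hTR, CStarMatrix.neg_apply, neg_neg]
      _ = -∑ i, ∑ l, star (T i j) * M i l * T l j := by
          simp only [CStarMatrix.mul_apply, CStarMatrix.star_apply, Finset.sum_mul]
          rw [Finset.sum_comm]
  refine eq_zero_of_sum_star_mul_self_nonpos (r := fun i => R i j) ?_ k
  exact hform.trans_le (neg_nonpos.2 (h fun i => T i j))

theorem starOrderedRing_of_isClosed {P : StarSubalgebra ℂ B} (hP : IsClosed (P : Set B)) :
    StarOrderedRing P := by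
  refine StarOrderedRing.of_nonneg_iff' (fun {x y} hxy z => ?_) fun x => ⟨fun hx => ?_, ?_⟩
  · exact add_le_add_right (show (x : B) ≤ y from hxy) (z : B)
  · have hx' : 0 ≤ (x : B) := hx
    have hsa : IsSelfAdjoint x := Subtype.ext hx'.isSelfAdjoint
    let _ := CStarAlgebra.spectralOrder P
    have := CStarAlgebra.spectralOrderedRing P
    refine CStarAlgebra.nonneg_iff_eq_star_mul_self.1
      ((StarOrderedRing.nonneg_iff_spectrum_nonneg (R := ℝ) x hsa).2 fun r hr => ?_)
    refine spectrum_nonneg_of_nonneg hx' ?_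
    rw [← spectrum.algebraMap_mem_iff ℂ] at hr ⊢
    rwa [← StarSubalgebra.spectrum_eq]
  · rintro ⟨s, rfl⟩
    exact star_mul_self_nonneg (s : B)

end CStarAlgebra

/-! ### Comparison, and subsequences in `A^∞` -/

section Comparison

theorem MurrayVonNeumannEquiv.map_eq_zero {B C : Type*} [Semiring B] [Star B] [Semiring C]
    {p q : B} (h : MurrayVonNeumannEquiv p q) (hp : IsIdempotentElem p) {f : B →+* C}
    (hq : f q = 0) : f p = 0 := by
  obtain ⟨v, rfl, rfl⟩ := h
  rw [← hp.eq, mul_assoc, ← mul_assoc v, map_mul, map_mul, hq, zero_mul, mul_zero]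

theorem map_eq_zero_of_mem_hereditarySubalgebra {B C : Type*} [Semiring B] [TopologicalSpace B]
    [Semiring C] [TopologicalSpace C] [T1Space C] {f : B →+* C} (hf : Continuous f) {z q : B}
    (hz : f z = 0) (hq : q ∈ hereditarySubalgebra z) : f q = 0 := by
  refine closure_minimal (t := f ⁻¹' {0}) ?_ (isClosed_singleton.preimage hf) hq
  rintro _ ⟨x, rfl⟩
  simp [hz]

theorem cuntzSubequiv_of_forall_exists_norm_lt {B : Type*} [SeminormedRing B] [Star B] {a b : B}
    (h : ∀ ε > 0, ∃ x : B, ‖star x * b * x - a‖ < ε) : CuntzSubequiv a b := by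
  have ha : a ∈ closure (Set.range fun x : B => star x * b * x) := by
    refine Metric.mem_closure_range_iff.2 fun ε hε => ?_
    simpa only [dist_comm a, dist_eq_norm] using h ε hε
  obtain ⟨y, hy, hya⟩ := mem_closure_iff_seq_limit.1 ha
  choose x hx using hy
  exact ⟨x, by simpa only [hx] using hya⟩

end Comparison

instance isClosed_nullSeq (A : Type*) [CStarAlgebra A] :
    IsClosed (nullSeq A : Set (ℕ →ᵇ A)) := by
  convert ZeroAtInftyContinuousMap.isClosed_range_toBCF (α := ℕ) (β := A)
  ext x
  rw [SetLike.mem_coe, mem_nullSeq, ← tendsto_zero_iff_norm_tendsto_zero, ← cocompact_eq_atTop]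
  exact ⟨fun h => ⟨⟨x.toContinuousMap, h⟩, rfl⟩, by rintro ⟨y, rfl⟩; exact y.zero_at_infty'⟩

namespace SeqAlg

variable {A B : Type*} [CStarAlgebra A] [CStarAlgebra B]

theorem isOpenQuotientMap_mk : IsOpenQuotientMap (mk : (ℕ →ᵇ A) → SeqAlg A) :=
  QuotientAddGroup.isOpenQuotientMap_mk

theorem mk_sum {ι : Type*} (s : Finset ι) (f : ι → ℕ →ᵇ A) :
    mk (∑ i ∈ s, f i) = ∑ i ∈ s, mk (f i) :=
  map_sum (Ideal.Quotient.mk (nullSeq A)) f s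

theorem const_mul (a b : A) : const (a * b) = const a * const b := rfl

theorem star_const (a : A) : star (const a) = const (star a) := rfl

theorem const_sum {ι : Type*} (s : Finset ι) (f : ι → A) :
    const (∑ i ∈ s, f i) = ∑ i ∈ s, const (f i) :=
  map_sum (AddMonoidHom.mk' const fun _ _ => rfl) f s

theorem const_injective : Function.Injective (const : A → SeqAlg A) := fun a b h => by
  have hab := mk_eq_mk.1 h
  simpa [sub_eq_zero] using hab

theorem continuous_const : Continuous (const : A → SeqAlg A) :=
  isOpenQuotientMap_mk.continuous.comp <| LipschitzWith.continuous <| LipschitzWith.mk_one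
    fun _ _ => (BoundedContinuousFunction.dist_le dist_nonneg).2 fun _ => le_rfl

theorem commute_const {a : A} (ha : ∀ x, Commute a x) (y : SeqAlg A) : Commute (const a) y := by
  obtain ⟨y, rfl⟩ := mk_surjective y
  exact congrArg mk (BoundedContinuousFunction.ext fun n => ha (y n))

theorem map_const (T : A →L[ℂ] B) (a : A) : map T (const a) = const (T a) := rfl

protected theorem map_sum {ι : Type*} (T : A →L[ℂ] B) (s : Finset ι) (f : ι → SeqAlg A) :
    map T (∑ i ∈ s, f i) = ∑ i ∈ s, map T (f i) := by
  choose g hg using fun i => mk_surjective (f i)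
  simp only [← hg, ← mk_sum, map_mk, _root_.map_sum]

theorem eventually_eventually_norm_sub_lt {ι : Type*} {l : Filter ι} {x : ι → ℕ →ᵇ A} {a : A}
    (h : Tendsto (fun k => mk (x k)) l (𝓝 (const a))) {ε : ℝ} (hε : 0 < ε) :
    ∀ᶠ k in l, ∀ᶠ n in atTop, ‖x k n - a‖ < ε := by
  have hnhds := isOpenQuotientMap_mk.isOpenMap.image_mem_nhds
    (Metric.ball_mem_nhds (BoundedContinuousFunction.const ℕ a) hε)
  filter_upwards [h hnhds] with k ⟨y, hy, hyx⟩
  filter_upwards [(mk_eq_mk.1 hyx.symm).eventually_lt_const (sub_pos.2 hy)] with n hn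
  have hya : ‖y n - a‖ ≤ dist y (BoundedContinuousFunction.const ℕ a) := by
    rw [← dist_eq_norm]
    exact BoundedContinuousFunction.dist_coe_le_dist (f := y)
      (g := BoundedContinuousFunction.const ℕ a) n
  linarith [norm_sub_le_norm_sub_add_norm_sub (x k n) (y n) a]

theorem eq_zero_of_sum_mul_star_eq_zero {ι : Type*} [Fintype ι] {d : ι → SeqAlg A}
    (h : ∑ i, d i * star (d i) = 0) (i : ι) : d i = 0 := by
  let _ := CStarAlgebra.spectralOrder A
  have := CStarAlgebra.spectralOrderedRing A
  choose x hx using fun i => mk_surjective (d i)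
  have hsum : Tendsto (fun n => ‖∑ i, x i n * star (x i n)‖) atTop (𝓝 0) := by
    have hmk : mk (∑ i, x i * star (x i)) = mk 0 := by
      rw [mk_sum]
      exact (Finset.sum_congr rfl fun i _ => by rw [← hx i]; rfl).trans h
    simpa using mk_eq_mk.1 hmk
  have hsq : Tendsto (fun n => ‖x i n‖ ^ 2) atTop (𝓝 0) := by
    refine squeeze_zero (fun _ => sq_nonneg _) (fun n => ?_) hsum
    rw [sq, ← CStarRing.norm_self_mul_star]
    exact CStarAlgebra.norm_le_norm_of_nonneg_of_le (mul_star_self_nonneg _)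
      (Finset.single_le_sum (fun j _ => mul_star_self_nonneg (x j n)) (Finset.mem_univ i))
  rw [← hx]
  refine mk_eq_mk.2 ?_
  simpa [Function.comp_def, Real.sqrt_sq] using (Real.continuous_sqrt.tendsto 0).comp hsq

/-- The image in `A^∞` of the indicator function of a set of natural numbers. -/
noncomputable def indicator (A : Type*) [CStarAlgebra A] (S : Set ℕ) : SeqAlg A :=
  mk (BoundedContinuousFunction.ofNormedAddCommGroupDiscrete (S.indicator 1) ‖(1 : A)‖
    fun _ => norm_indicator_le_norm_self _ _)

theorem isStarProjection_indicator (S : Set ℕ) : IsStarProjection (indicator A S) where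
  isIdempotentElem := congrArg mk (BoundedContinuousFunction.ext fun n => by
    by_cases hn : n ∈ S <;> simp [hn])
  isSelfAdjoint := congrArg mk (BoundedContinuousFunction.ext fun n => by
    by_cases hn : n ∈ S <;> simp [hn])

/-- Restriction to a subsequence, `[(x_n)] ↦ [(x_{φ(n)})]`. -/
noncomputable def reindex (φ : ℕ → ℕ) (hφ : Tendsto φ atTop atTop) : SeqAlg A →+* SeqAlg A :=
  Ideal.quotientMap (nullSeq A)
    { toFun := fun x => x.compContinuous ⟨φ, continuous_of_discreteTopology⟩
      map_zero' := rfl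
      map_one' := rfl
      map_add' := fun _ _ => rfl
      map_mul' := fun _ _ => rfl }
    fun _ hx => (mem_nullSeq.1 hx).comp hφ

section reindex

variable {φ : ℕ → ℕ} (hφ : Tendsto φ atTop atTop)

theorem reindex_const (a : A) : reindex φ hφ (const a) = const a := rfl

theorem reindex_star (x : SeqAlg A) : reindex φ hφ (star x) = star (reindex φ hφ x) := by
  obtain ⟨x, rfl⟩ := mk_surjective x
  rfl

theorem reindex_map (T : A →L[ℂ] A) (x : SeqAlg A) :
    reindex φ hφ (map T x) = map T (reindex φ hφ x) := by
  obtain ⟨x, rfl⟩ := mk_surjective x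
  rfl

theorem continuous_reindex : Continuous (reindex φ hφ : SeqAlg A → SeqAlg A) :=
  isOpenQuotientMap_mk.isQuotientMap.continuous_iff.2
    (isOpenQuotientMap_mk.continuous.comp
      (BoundedContinuousFunction.continuous_compContinuous _))

theorem reindex_indicator_of_forall_mem {S : Set ℕ} (h : ∀ n, φ n ∈ S) :
    reindex φ hφ (indicator A S) = 1 :=
  congrArg mk (BoundedContinuousFunction.ext fun n => Set.indicator_of_mem (h n) _)

theorem reindex_indicator_of_forall_notMem {S : Set ℕ} (h : ∀ n, φ n ∉ S) :
    reindex φ hφ (indicator A S) = 0 :=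
  congrArg mk (BoundedContinuousFunction.ext fun n => Set.indicator_of_notMem (h n) _)

end reindex

end SeqAlg

/-! ### Conditional expectations and quasi-bases -/

namespace ConditionalExpectation

variable {A : Type*} [CStarAlgebra A] [PartialOrder A] [StarOrderedRing A]
  {P : StarSubalgebra ℂ A}

section Basic

variable (E : ConditionalExpectation P)

theorem toSelf_mem (x : A) : E.toSelf x ∈ P := (E.toCLM x).2

theorem toSelf_of_mem {p : A} (hp : p ∈ P) : E.toSelf p = p :=
  congrArg Subtype.val (E.map_coe ⟨p, hp⟩)

theorem toSelf_mul_left {p : A} (hp : p ∈ P) (x : A) : E.toSelf (p * x) = p * E.toSelf x :=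
  congrArg Subtype.val (E.map_mul_left ⟨p, hp⟩ x)

theorem toSelf_mul_right (x : A) {p : A} (hp : p ∈ P) : E.toSelf (x * p) = E.toSelf x * p :=
  congrArg Subtype.val (E.map_mul_right x ⟨p, hp⟩)

theorem toSelf_star (x : A) : E.toSelf (star x) = star (E.toSelf x) :=
  map_star (PositiveLinearMap.mk₀ (E.toSelf : A →ₗ[ℂ] A) E.map_nonneg) x

theorem isClosed (E : ConditionalExpectation P) : IsClosed (P : Set A) := by
  have hP : (P : Set A) = {x | E.toSelf x = x} :=
    Set.ext fun x => ⟨E.toSelf_of_mem, fun hx => hx ▸ E.toSelf_mem x⟩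
  rw [hP]
  exact isClosed_eq E.toSelf.continuous continuous_id

theorem toSelf_star_sum_mul_sum {ι : Type*} [Fintype ι] (u : ι → A) (p : ι → P) :
    E.toSelf (star (∑ i, u i * p i) * ∑ i, u i * p i) =
      ((∑ i, ∑ j, star (p i) * E.toCLM (star (u i) * u j) * p j : P) : A) := by
  simp only [star_sum, Finset.sum_mul_sum, map_sum, AddSubmonoidClass.coe_finsetSum]
  refine Finset.sum_congr rfl fun i _ => Finset.sum_congr rfl fun j _ => ?_
  calc E.toSelf (star (u i * p i) * (u j * p j)) =
        E.toSelf (star (p i : A) * (star (u i) * u j * p j)) := by rw [star_mul]; noncomm_ring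
    _ = star (p i : A) * E.toSelf (star (u i) * u j) * p j := by
      rw [E.toSelf_mul_left (star_mem (p i).2), E.toSelf_mul_right _ (p j).2, mul_assoc]

theorem exists_gram_eq_sum_star_mul {ι : Type*} [Fintype ι] (u : ι → A) :
    ∃ R : ι → ι → P, ∀ i j, E.toCLM (star (u i) * u j) = ∑ k, star (R k i) * R k j := by
  have := E.isClosed
  have := starOrderedRing_of_isClosed E.isClosed
  let M : CStarMatrix ι ι P := CStarMatrix.ofMatrix fun i j => E.toCLM (star (u i) * u j)
  have hM : IsSelfAdjoint M := by
    ext i j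
    change star (E.toSelf (star (u j) * u i)) = E.toSelf (star (u i) * u j)
    rw [← toSelf_star, star_mul, star_star]
  obtain ⟨R, hR⟩ := cstarMatrix_exists_eq_star_mul_self hM fun p =>
    (E.map_nonneg _ (star_mul_self_nonneg _)).trans_eq (E.toSelf_star_sum_mul_sum u p)
  refine ⟨fun k i => R k i, fun i j => ?_⟩
  calc E.toCLM (star (u i) * u j) = (star R * R) i j := by rw [← hR]; rfl
    _ = ∑ k, star (R k i) * R k j := by simp only [CStarMatrix.mul_apply, CStarMatrix.star_apply]

theorem map_map (x : SeqAlg A) :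
    SeqAlg.map E.toSelf (SeqAlg.map E.toSelf x) = SeqAlg.map E.toSelf x := by
  obtain ⟨x, rfl⟩ := SeqAlg.mk_surjective x
  exact congrArg SeqAlg.mk (BoundedContinuousFunction.ext fun n =>
    E.toSelf_of_mem (E.toSelf_mem (x n)))

theorem map_star (x : SeqAlg A) :
    SeqAlg.map E.toSelf (star x) = star (SeqAlg.map E.toSelf x) := by
  obtain ⟨x, rfl⟩ := SeqAlg.mk_surjective x
  exact congrArg SeqAlg.mk (BoundedContinuousFunction.ext fun n => E.toSelf_star (x n))

theorem map_const_of_mem {p : A} (hp : p ∈ P) :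
    SeqAlg.map E.toSelf (SeqAlg.const p) = SeqAlg.const p := by
  rw [SeqAlg.map_const, E.toSelf_of_mem hp]

theorem map_mul_of_map_eq (x : SeqAlg A) {y : SeqAlg A} (hy : SeqAlg.map E.toSelf y = y) :
    SeqAlg.map E.toSelf (x * y) = SeqAlg.map E.toSelf x * y := by
  rw [← hy]
  obtain ⟨x, rfl⟩ := SeqAlg.mk_surjective x
  obtain ⟨y, rfl⟩ := SeqAlg.mk_surjective y
  exact congrArg SeqAlg.mk (BoundedContinuousFunction.ext fun n =>
    E.toSelf_mul_right (x n) (E.toSelf_mem (y n)))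

theorem cuntzSubequiv_of_tendsto {ι : Type*} {l : Filter ι} [l.NeBot] {x : ι → SeqAlg A}
    (hx : ∀ k, SeqAlg.map E.toSelf (x k) = x k) {a b : P}
    (h : Tendsto (fun k => star (x k) * SeqAlg.const (b : A) * x k) l
      (𝓝 (SeqAlg.const (a : A)))) : CuntzSubequiv a b := by
  choose y hy using fun k => SeqAlg.mk_surjective (x k)
  have hmk (k : ι) : star (x k) * SeqAlg.const (b : A) * x k =
      SeqAlg.mk (star (E.toSelf.compLeftContinuousBounded ℕ (y k)) *
        BoundedContinuousFunction.const ℕ (b : A) *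
          E.toSelf.compLeftContinuousBounded ℕ (y k)) := by
    rw [← hx, ← hy]
    rfl
  simp only [hmk] at h
  refine cuntzSubequiv_of_forall_exists_norm_lt fun ε hε => ?_
  obtain ⟨k, hk⟩ := (SeqAlg.eventually_eventually_norm_sub_lt h hε).exists
  obtain ⟨n, hn⟩ := hk.exists
  exact ⟨E.toCLM (y k n), hn⟩

end Basic

section QuasiBasis

variable {E : ConditionalExpectation P} {n : ℕ} {u v : Fin n → A}

theorem IsQuasiBasis.star_swap (h : E.IsQuasiBasis u v) :
    E.IsQuasiBasis (fun i => star (v i)) fun i => star (u i) := fun x => by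
  constructor
  · simpa only [star_sum, star_mul, ← toSelf_star, star_star] using congrArg star (h (star x)).2
  · simpa only [star_sum, star_mul, ← toSelf_star, star_star] using congrArg star (h (star x)).1

theorem IndexFiniteType.isSelfAdjoint_index (hE : E.IndexFiniteType) : IsSelfAdjoint E.index := by
  obtain ⟨n, u, v, h⟩ := hE
  calc star E.index = ∑ i, star (v i) * star (u i) := by
        simp only [index_eq h, star_sum, star_mul]
    _ = E.index := (index_eq h.star_swap).symm

theorem IndexFiniteType.commute_index (hE : E.IndexFiniteType) (x : A) : Commute E.index x := by
  obtain ⟨n, u, v, h⟩ := hE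
  calc E.index * x = ∑ j, u j * ∑ i, E.toSelf (v j * x * u i) * v i := by
        rw [index_eq h, Finset.sum_mul]
        exact Finset.sum_congr rfl fun j _ => by rw [(h (v j * x)).2, mul_assoc]
    _ = ∑ i, (∑ j, u j * E.toSelf (v j * (x * u i))) * v i := by
        simp only [Finset.mul_sum, Finset.sum_mul, mul_assoc]
        exact Finset.sum_comm
    _ = x * E.index := by
        rw [index_eq h, Finset.mul_sum]
        exact Finset.sum_congr rfl fun i _ => by rw [(h (x * u i)).1, mul_assoc]

theorem IsQuasiBasis.sum_const_mul_map (h : E.IsQuasiBasis u v) (y : SeqAlg A) :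
    ∑ i, SeqAlg.const (u i) * SeqAlg.map E.toSelf (SeqAlg.const (v i) * y) = y := by
  obtain ⟨y, rfl⟩ := SeqAlg.mk_surjective y
  refine (SeqAlg.mk_sum Finset.univ fun i => BoundedContinuousFunction.const ℕ (u i) *
    E.toSelf.compLeftContinuousBounded ℕ (BoundedContinuousFunction.const ℕ (v i) * y)).symm.trans
    (congrArg SeqAlg.mk (BoundedContinuousFunction.ext fun n => ?_))
  rw [BoundedContinuousFunction.sum_apply]
  exact (h (y n)).1

theorem IsQuasiBasis.sum_map_mul_const (h : E.IsQuasiBasis u v) (y : SeqAlg A) :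
    ∑ i, SeqAlg.map E.toSelf (y * SeqAlg.const (u i)) * SeqAlg.const (v i) = y := by
  obtain ⟨y, rfl⟩ := SeqAlg.mk_surjective y
  refine (SeqAlg.mk_sum Finset.univ fun i =>
    E.toSelf.compLeftContinuousBounded ℕ (y * BoundedContinuousFunction.const ℕ (u i)) *
      BoundedContinuousFunction.const ℕ (v i)).symm.trans
    (congrArg SeqAlg.mk (BoundedContinuousFunction.ext fun n => ?_))
  rw [BoundedContinuousFunction.sum_apply]
  exact (h (y n)).2

theorem IndexFiniteType.exists_isQuasiBasis_star (hE : E.IndexFiniteType) :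
    ∃ (n : ℕ) (w : Fin n → A), E.IsQuasiBasis w fun i => star (w i) := by
  obtain ⟨n, u, v, h⟩ := hE
  -- The Gram matrix of `u` factors as `R⋆ R` over `P`, and `(u, v)` may be traded for `w = (R v)⋆`.
  obtain ⟨R, hR⟩ := E.exists_gram_eq_sum_star_mul u
  have hR' (i j : Fin n) :
      E.toSelf (star (u i) * u j) = ∑ k, star (R k i : A) * (R k j : A) := by
    rw [toSelf_apply, hR, AddSubmonoidClass.coe_finsetSum]
    rfl
  let w : Fin n → A := fun k => ∑ j, star (v j) * star (R k j : A)
  have hw (k : Fin n) (x : A) :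
      E.toSelf (star (w k) * x) = ∑ j, (R k j : A) * E.toSelf (v j * x) := by
    simp only [w, star_sum, star_mul, star_star, Finset.sum_mul, map_sum, mul_assoc,
      E.toSelf_mul_left (R k _).2]
  have hu (i : Fin n) (x : A) :
      ∑ j, E.toSelf (star (u i) * u j) * E.toSelf (v j * x) = E.toSelf (star (u i) * x) := by
    simp only [← E.toSelf_mul_right _ (E.toSelf_mem _), mul_assoc, ← map_sum, ← Finset.mul_sum,
      (h x).1]
  have hleft (x : A) : ∑ k, w k * E.toSelf (star (w k) * x) = x :=
    calc ∑ k, w k * E.toSelf (star (w k) * x)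
        = ∑ k, ∑ i, ∑ j, star (v i) * (star (R k i : A) * R k j * E.toSelf (v j * x)) := by
          simp only [hw, w, Finset.sum_mul_sum, mul_assoc]
      _ = ∑ i, ∑ j, ∑ k, star (v i) * (star (R k i : A) * R k j * E.toSelf (v j * x)) := by
          rw [Finset.sum_comm]
          exact Finset.sum_congr rfl fun i _ => Finset.sum_comm
      _ = ∑ i, star (v i) * E.toSelf (star (u i) * x) := by
          simp only [← Finset.mul_sum, ← Finset.sum_mul, ← hR', hu]
      _ = x := (h.star_swap x).1
  refine ⟨n, w, fun x => ⟨hleft x, ?_⟩⟩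
  simpa only [star_sum, star_mul, ← toSelf_star, star_star] using congrArg star (hleft (star x))

end QuasiBasis

/-! ### Rokhlin projections -/

/-- A projection `e ∈ A' ∩ A^∞` with `(Index E) E^∞(e) = 1`, as in the Rokhlin property of `E`
without a tracial defect; injectivity of `A ∋ x ↦ x e` is not required. -/
structure IsRokhlinProjection (E : ConditionalExpectation P) (e : SeqAlg A) : Prop where
  isStarProjection : IsStarProjection e
  commute_const (x : A) : Commute e (SeqAlg.const x)
  index_mul_map : SeqAlg.const E.index * SeqAlg.map E.toSelf e = 1

theorem TracialRokhlinProperty.exists_isRokhlinProjection {E : ConditionalExpectation P}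
    (hE : E.TracialRokhlinProperty) : ∃ e, E.IsRokhlinProjection e := by
  rcases subsingleton_or_nontrivial (SeqAlg A) with _ | _
  · exact ⟨0, .zero _, fun _ => .zero_left _, Subsingleton.elim _ _⟩
  have heven : Tendsto (fun n : ℕ => 2 * n) atTop atTop :=
    StrictMono.tendsto_atTop fun m n h => by lia
  have hodd : Tendsto (fun n : ℕ => 2 * n + 1) atTop atTop :=
    StrictMono.tendsto_atTop fun m n h => by lia
  -- Nonzero, but zero along the odd numbers: there the defect `1 - g` is forced to vanish.
  let z := SeqAlg.indicator A {n | Even n}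
  have hz : z ≠ 0 := fun h => by
    have hone : SeqAlg.reindex _ heven z = 1 :=
      SeqAlg.reindex_indicator_of_forall_mem heven even_two_mul
    exact one_ne_zero (hone.symm.trans (by rw [h, map_zero]))
  have hz_odd : SeqAlg.reindex _ hodd z = 0 :=
    SeqAlg.reindex_indicator_of_forall_notMem hodd fun n => Nat.not_even_two_mul_add_one n
  have hzp : IsStarProjection z := SeqAlg.isStarProjection_indicator _
  obtain ⟨e, he, hcomm, g, hg, hgp, ⟨q, hq, -, hgq⟩, -⟩ :=
    hE z hz ⟨z, by rw [hzp.isSelfAdjoint.star_eq, hzp.isIdempotentElem.eq]⟩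
  have hdefect : SeqAlg.reindex _ hodd (1 - g) = 0 :=
    hgq.map_eq_zero hgp.isIdempotentElem.one_sub
      (map_eq_zero_of_mem_hereditarySubalgebra (SeqAlg.continuous_reindex hodd) hz_odd hq)
  refine ⟨SeqAlg.reindex _ hodd e, ⟨he.isIdempotentElem.map _, ?_⟩, fun x => ?_, ?_⟩
  · rw [isSelfAdjoint_iff, ← SeqAlg.reindex_star, he.isSelfAdjoint.star_eq]
  · exact (show Commute e (SeqAlg.const x) from (hcomm x).symm).map (SeqAlg.reindex _ hodd)
  · rw [map_sub, map_one, sub_eq_zero] at hdefect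
    rw [hdefect, hg, map_mul, SeqAlg.reindex_map, SeqAlg.reindex_const]

/-- The map `x ↦ (Index E) E^∞(e x)`, which for a Rokhlin projection `e` is multiplicative on the
commutant of `e` and takes values in the fixed points of `E^∞`. -/
noncomputable def rokhlinMap (E : ConditionalExpectation P) (e x : SeqAlg A) : SeqAlg A :=
  SeqAlg.const E.index * SeqAlg.map E.toSelf (e * x)

section RokhlinMap

variable {E : ConditionalExpectation P} {e : SeqAlg A}

theorem rokhlinMap_mul_of_map_eq (x : SeqAlg A) {y : SeqAlg A} (hy : SeqAlg.map E.toSelf y = y) :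
    E.rokhlinMap e (x * y) = E.rokhlinMap e x * y := by
  rw [rokhlinMap, ← mul_assoc, E.map_mul_of_map_eq _ hy, ← mul_assoc, rokhlinMap]

theorem rokhlinMap_sum {ι : Type*} (s : Finset ι) (f : ι → SeqAlg A) :
    E.rokhlinMap e (∑ i ∈ s, f i) = ∑ i ∈ s, E.rokhlinMap e (f i) := by
  simp only [rokhlinMap, Finset.mul_sum, SeqAlg.map_sum]

theorem continuous_rokhlinMap (E : ConditionalExpectation P) (e : SeqAlg A) :
    Continuous (E.rokhlinMap e) := by
  obtain ⟨e, rfl⟩ := SeqAlg.mk_surjective e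
  refine SeqAlg.isOpenQuotientMap_mk.isQuotientMap.continuous_iff.2
    (SeqAlg.isOpenQuotientMap_mk.continuous.comp (f := fun x : ℕ →ᵇ A =>
      BoundedContinuousFunction.const ℕ E.index *
        E.toSelf.compLeftContinuousBounded ℕ (e * x)) ?_)
  fun_prop

namespace IsRokhlinProjection

theorem rokhlinMap_of_map_eq (he : E.IsRokhlinProjection e) {x : SeqAlg A}
    (hx : SeqAlg.map E.toSelf x = x) : E.rokhlinMap e x = x := by
  rw [rokhlinMap, E.map_mul_of_map_eq _ hx, ← mul_assoc, he.index_mul_map, one_mul]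

theorem index_mem (he : E.IsRokhlinProjection e) (hfin : E.IndexFiniteType) : E.index ∈ P := by
  have hleft : SeqAlg.const (E.toSelf E.index) * SeqAlg.map E.toSelf e = 1 := by
    rw [← SeqAlg.map_const, ← E.map_mul_of_map_eq _ (E.map_map e), he.index_mul_map]
    exact E.map_const_of_mem (one_mem P)
  have hright : SeqAlg.map E.toSelf e * SeqAlg.const E.index = 1 := by
    rw [← (SeqAlg.commute_const hfin.commute_index _).eq, he.index_mul_map]
  rw [← SeqAlg.const_injective (left_inv_eq_right_inv hleft hright)]
  exact E.toSelf_mem _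

theorem map_rokhlinMap (he : E.IsRokhlinProjection e) (hfin : E.IndexFiniteType) (x : SeqAlg A) :
    SeqAlg.map E.toSelf (E.rokhlinMap e x) = E.rokhlinMap e x := by
  rw [rokhlinMap, E.map_mul_of_map_eq _ (E.map_map _), E.map_const_of_mem (he.index_mem hfin)]

theorem rokhlinMap_star (he : E.IsRokhlinProjection e) (hfin : E.IndexFiniteType) {x : SeqAlg A}
    (hx : Commute e x) : E.rokhlinMap e (star x) = star (E.rokhlinMap e x) := by
  rw [rokhlinMap, rokhlinMap, star_mul, SeqAlg.star_const, hfin.isSelfAdjoint_index.star_eq,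
    ← E.map_star, hx.eq, star_mul, he.isStarProjection.isSelfAdjoint.star_eq,
    (SeqAlg.commute_const hfin.commute_index _).eq]

section Defect

variable {n : ℕ} {w : Fin n → A}

theorem sum_rokhlinMap_mul_star_const (h : E.IsQuasiBasis w fun i => star (w i)) :
    ∑ i, E.rokhlinMap e (SeqAlg.const (w i)) * star (SeqAlg.const (w i)) =
      SeqAlg.const E.index * e := by
  simp only [rokhlinMap, mul_assoc, SeqAlg.star_const, ← Finset.mul_sum, h.sum_map_mul_const]

theorem sum_rokhlinMap_mul_star_rokhlinMap (he : E.IsRokhlinProjection e)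
    (h : E.IsQuasiBasis w fun i => star (w i)) :
    ∑ i, E.rokhlinMap e (SeqAlg.const (w i)) * star (E.rokhlinMap e (SeqAlg.const (w i))) =
      SeqAlg.const E.index := by
  have hfin : E.IndexFiniteType := ⟨_, _, _, h⟩
  have hJ := E.map_const_of_mem (he.index_mem hfin)
  have hfix (i : Fin n) := congrArg star (he.map_rokhlinMap hfin (SeqAlg.const (w i)))
  simp only [← E.map_star] at hfix
  calc ∑ i, E.rokhlinMap e (SeqAlg.const (w i)) * star (E.rokhlinMap e (SeqAlg.const (w i)))
      = E.rokhlinMap e (star (∑ i, E.rokhlinMap e (SeqAlg.const (w i)) *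
          star (SeqAlg.const (w i)))) := by
        simp only [← rokhlinMap_mul_of_map_eq _ (hfix _), ← rokhlinMap_sum, star_sum, star_mul,
          star_star]
    _ = E.rokhlinMap e (e * SeqAlg.const E.index) := by
        rw [sum_rokhlinMap_mul_star_const h, star_mul, SeqAlg.star_const,
          hfin.isSelfAdjoint_index.star_eq, he.isStarProjection.isSelfAdjoint.star_eq]
    _ = SeqAlg.const E.index := by
        rw [rokhlinMap_mul_of_map_eq _ hJ, rokhlinMap, he.isStarProjection.isIdempotentElem.eq,
          he.index_mul_map, one_mul]

theorem mul_rokhlinMap_const (he : E.IsRokhlinProjection e)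
    (h : E.IsQuasiBasis w fun i => star (w i)) (i : Fin n) :
    e * E.rokhlinMap e (SeqAlg.const (w i)) = e * SeqAlg.const (w i) := by
  have hfin : E.IndexFiniteType := ⟨_, _, _, h⟩
  set J := SeqAlg.const E.index with hJ
  set W := fun i => SeqAlg.const (w i)
  set B := fun i => E.rokhlinMap e (W i)
  have hes := he.isStarProjection.isSelfAdjoint.star_eq
  have hee := he.isStarProjection.isIdempotentElem.eq
  have hJs : star J = J := by rw [hJ, SeqAlg.star_const, hfin.isSelfAdjoint_index.star_eq]
  have hWW : ∑ i, W i * star (W i) = J := by rw [hJ, index_eq h, SeqAlg.const_sum]; rfl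
  have hBW : ∑ i, B i * star (W i) = J * e := sum_rokhlinMap_mul_star_const h
  have hWB : ∑ i, W i * star (B i) = e * J := by
    simpa only [star_sum, star_mul, star_star, hes, hJs] using congrArg star hBW
  have hBB : ∑ i, B i * star (B i) = J := he.sum_rokhlinMap_mul_star_rokhlinMap h
  -- `∑ (B i - W i) (B i - W i)⋆ = 2J - Je - eJ` is compressed to `0` by `e`.
  have hdefect : ∑ i, e * (B i - W i) * star (e * (B i - W i)) = 0 := by
    calc ∑ i, e * (B i - W i) * star (e * (B i - W i))
        = e * (∑ i, B i * star (B i) - ∑ i, B i * star (W i) - ∑ i, W i * star (B i) +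
            ∑ i, W i * star (W i)) * e := by
          simp only [← Finset.sum_sub_distrib, ← Finset.sum_add_distrib, Finset.mul_sum,
            Finset.sum_mul, star_mul, star_sub, hes]
          exact Finset.sum_congr rfl fun i _ => by noncomm_ring
      _ = (e * J) * e - (e * J) * (e * e) - (e * e) * (J * e) + e * (J * e) := by
          rw [hBB, hBW, hWB, hWW]
          noncomm_ring
      _ = 0 := by
          rw [hee, mul_assoc]
          noncomm_ring
  rw [← sub_eq_zero, ← mul_sub]
  exact SeqAlg.eq_zero_of_sum_mul_star_eq_zero hdefect i

end Defect

theorem mul_rokhlinMap (he : E.IsRokhlinProjection e) (hfin : E.IndexFiniteType) (y : SeqAlg A) :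
    e * E.rokhlinMap e y = e * y := by
  obtain ⟨n, w, h⟩ := hfin.exists_isQuasiBasis_star
  rw [← h.sum_const_mul_map y, rokhlinMap_sum]
  simp only [Finset.mul_sum, rokhlinMap_mul_of_map_eq _ (E.map_map _), ← mul_assoc,
    he.mul_rokhlinMap_const h]

theorem rokhlinMap_mul (he : E.IsRokhlinProjection e) (hfin : E.IndexFiniteType) {x : SeqAlg A}
    (hx : Commute e x) (y : SeqAlg A) :
    E.rokhlinMap e (x * y) = E.rokhlinMap e x * E.rokhlinMap e y := by
  have hexy : e * (x * y) = e * (x * E.rokhlinMap e y) := by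
    rw [← mul_assoc, hx.eq, mul_assoc, ← he.mul_rokhlinMap hfin, ← mul_assoc, ← hx.eq, mul_assoc]
  rw [rokhlinMap, hexy, ← rokhlinMap, rokhlinMap_mul_of_map_eq _ (he.map_rokhlinMap hfin y)]

end IsRokhlinProjection

end RokhlinMap

end ConditionalExpectation

theorem proposition6p2_general {A : Type*} [CStarAlgebra A] [PartialOrder A] [StarOrderedRing A]
    {P : StarSubalgebra ℂ A} (E : ConditionalExpectation P) (hfin : E.IndexFiniteType)
    {e : SeqAlg A} (he : E.IsRokhlinProjection e) (a b : P)
    (hab : CuntzSubequiv (a : A) (b : A)) :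
    CuntzSubequiv a b := by
  obtain ⟨x, hx⟩ := hab
  have hβ (p : P) : E.rokhlinMap e (SeqAlg.const (p : A)) = SeqAlg.const (p : A) :=
    he.rokhlinMap_of_map_eq (E.map_const_of_mem p.2)
  have hβx (k : ℕ) : E.rokhlinMap e (SeqAlg.const (star (x k) * b * x k)) =
      star (E.rokhlinMap e (SeqAlg.const (x k))) * SeqAlg.const (b : A) *
        E.rokhlinMap e (SeqAlg.const (x k)) := by
    rw [SeqAlg.const_mul, he.rokhlinMap_mul hfin (he.commute_const _), SeqAlg.const_mul,
      he.rokhlinMap_mul hfin (he.commute_const _), ← SeqAlg.star_const,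
      he.rokhlinMap_star hfin (he.commute_const _), hβ]
  refine E.cuntzSubequiv_of_tendsto (fun k => he.map_rokhlinMap hfin (SeqAlg.const (x k)))
    (l := atTop) ?_
  have hcont := (E.continuous_rokhlinMap e).comp SeqAlg.continuous_const
  simpa only [Function.comp_def, hβ, hβx] using (hcont.tendsto (a : A)).comp hx

theorem proposition6p2 {A : Type*} [CStarAlgebra A] [PartialOrder A] [StarOrderedRing A]
    (P : StarSubalgebra ℂ A) (hP : IsClosed (P : Set A))
    (E : ConditionalExpectation P) (hfin : E.IndexFiniteType)
    (hE : E.TracialRokhlinProperty)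
    (a b : P) (ha : 0 ≤ (a : A)) (hb : 0 ≤ (b : A))
    (hab : CuntzSubequiv (a : A) (b : A)) :
    CuntzSubequiv a b := by
  obtain ⟨e, he⟩ := hE.exists_isRokhlinProjection
  exact proposition6p2_general E hfin he a b hab
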